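/- For $\xi\in\mathbb{R}^{2\times 2}$ let $0\le\lambda_1(\xi)\le\lambda_2(\xi)$ denote the singular values of $\xi$. Let $K\subset\{(x,y)\in\mathbb{R}^2: 0\le x\le y\}$ be a nonempty compact set with $\min\{x:(x,y)\in K\}>0$, and let $$E=\{\xi\in\mathbb{R}^{2\times 2}:(\lambda_1(\xi),\lambda_2(\xi))\in K\}.$$ A function $f:\mathbb{R}^{2\times 2}\to\mathbb{R}\cup\{+\infty\}$ is called polyconvex if $f(\xi)=g(\xi,\det\xi)$ for some convex $g:\mathbb{R}^{2\times 2}\times\mathbb{R}\to\mathbb{R}\cup\{+\infty\}$, and the polyconvex hull of $E$ is $$\mathrm{Pco}\,E=\{\xi\in\mathbb{R}^{2\times 2}: f(\xi)\le 0\ \text{for every polyconvex } f:\mathbb{R}^{2\times 2}\to\mathbb{R}\cup\{+\infty\}\text{ with } f|_E\le 0\}.$$ Put $m(\theta)=\max_{(a,b)\in K}\{ab+\theta(b-a)\}$ and, for $x\ge 0$, $$\sigma(x)=\min_{\theta\in[0,\max_{(a,b)\in K}b]}\frac{\theta x+m(\theta)}{x+\theta},$$ where for $x=0$ the quotient at $\theta=0$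 is read as $+\infty$. Then this minimum is attained for every $x\ge 0$, the function $\sigma$ is continuous on $[0,\infty)$ (including at $0$), and $$\mathrm{int}\,\mathrm{Pco}\,E=\{\xi\in\mathbb{R}^{2\times 2}:\lambda_2(\xi)<\sigma(\lambda_1(\xi))\}.$$ -/

import Mathlib

noncomputable section

namespace IsotropicHull

/-- Real `2 × 2` matrices, with their usual (finite-dimensional) topology. -/
abbrev Mat2 : Type := Matrix (Fin 2) (Fin 2) ℝ

/-- The smaller singular value of a `2 × 2` matrix. Mathlib lists the singular values in
decreasing order, starting at index `0`. -/
def lam1 (ξ : Mat2) : ℝ := (Matrix.toEuclideanLin ξ).singularValues 1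

/-- The larger singular value of a `2 × 2` matrix. -/
def lam2 (ξ : Mat2) : ℝ := (Matrix.toEuclideanLin ξ).singularValues 0

/-- Convexity of a function with values in `ℝ ∪ {+∞}`; in `EReal` a positive real times `⊤`
is `⊤`. -/
def IsConvexExt {V : Type*} [AddCommGroup V] [Module ℝ V] (g : V → EReal) : Prop :=
  (∀ x, g x ≠ ⊥) ∧
    ∀ x y : V, ∀ a b : ℝ, 0 < a → 0 < b → a + b = 1 →
      g (a • x + b • y) ≤ (a : EReal) * g x + (b : EReal) * g y

/-- `f : ℝ^{2×2} → ℝ ∪ {+∞}` is polyconvex if it is a convex function (with values in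
`ℝ ∪ {+∞}`) of the matrix and its determinant. -/
def IsPolyconvex (f : Mat2 → EReal) : Prop :=
  ∃ g : Mat2 × ℝ → EReal, IsConvexExt g ∧ ∀ ξ, f ξ = g (ξ, ξ.det)

/-- The polyconvex hull of a set of matrices. -/
def Pco (E : Set Mat2) : Set Mat2 :=
  {ξ | ∀ f : Mat2 → EReal, IsPolyconvex f → (∀ η ∈ E, f η ≤ 0) → f ξ ≤ 0}

/-- The isotropic set of matrices whose pair of ordered singular values lies in `K`. -/
def isotropicSet (K : Set (ℝ × ℝ)) : Set Mat2 :=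
  {ξ | (lam1 ξ, lam2 ξ) ∈ K}

/-- `max {b : (a, b) ∈ K}`. -/
def maxB (K : Set (ℝ × ℝ)) : ℝ := sSup (Prod.snd '' K)

/-- `m(θ) = max {a b + θ (b - a) : (a, b) ∈ K}`. -/
def m (K : Set (ℝ × ℝ)) (θ : ℝ) : ℝ :=
  sSup ((fun p : ℝ × ℝ => p.1 * p.2 + θ * (p.2 - p.1)) '' K)

/-- The values `(θ x + m(θ)) / (x + θ)` for `θ ∈ [0, max b]`. For `x = 0` the parameter `θ = 0`,
at which the quotient is `+∞`, is left out. -/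
def sigmaValues (K : Set (ℝ × ℝ)) (x : ℝ) : Set ℝ :=
  {y | ∃ θ ∈ Set.Icc 0 (maxB K), 0 < x + θ ∧ y = (θ * x + m K θ) / (x + θ)}

/-- `σ(x)`, the minimum of `(θ x + m(θ)) / (x + θ)` over `θ ∈ [0, max b]`, for `x ≥ 0`. -/
def sigma (K : Set (ℝ × ℝ)) (x : ℝ) : ℝ := sInf (sigmaValues K x)

end IsotropicHull

end

namespace IsotropicHull

open Filter Topology

/-! Let `z`, `w` be the conformal and anticonformal parts of `ξ`. Then `λ₂ = |z| + |w|`, `λ₁ = ||z|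
- |w||` and `det ξ = |z|² - |w|²`. After clearing denominators, `λ₂ < σ(λ₁)` says that `λ₁λ₂ + θ(λ₂
- λ₁) < m(θ)` for all `θ ∈ [0, max b]`; this is `belowSigma`, an open condition.

Necessity: `gTheta` is convex in `(ξ, det ξ)` and nonpositive on `E`, which gives the weak
inequalities on the hull (`le_m_of_mem_Pco`). At an interior point, dilating `ξ` slightly makes them
strict.

Sufficiency: it is enough that `(z, w, det)` lies in the convex hull of the lift of `E`
(`mem_convexHull_liftedSet`). Otherwise a linear functional separates. Rotating `z` and `w`
independently preserves the lift, so only a function `s|z| + t|w| + γ det` matters, and the question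
becomes planar. There `exists_mem_le_of_forall_theta` rules out separation by comparing a level
hyperbola with the hyperbola of some `θ` sharing its tangent. -/

/-! ### Singular values through conformal and anticonformal parts -/

lemma lam1_nonneg (ξ : Mat2) : 0 ≤ lam1 ξ := LinearMap.singularValues_nonneg _ _

lemma lam1_le_lam2 (ξ : Mat2) : lam1 ξ ≤ lam2 ξ :=
  LinearMap.singularValues_antitone _ zero_le_one

lemma adjoint_comp_toEuclideanLin (ξ : Mat2) :
    (Matrix.toEuclideanLin ξ).adjoint ∘ₗ Matrix.toEuclideanLin ξ =
      Matrix.toLin (EuclideanSpace.basisFun (Fin 2) ℝ).toBasis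
        (EuclideanSpace.basisFun (Fin 2) ℝ).toBasis (ξ.conjTranspose * ξ) := by
  rw [← Matrix.toEuclideanLin_conjTranspose_eq_adjoint,
    Matrix.toEuclideanLin_eq_toLin_orthonormal, ← Matrix.toLin_mul]

lemma lam_sq_add_lam_sq (ξ : Mat2) :
    lam1 ξ ^ 2 + lam2 ξ ^ 2 = ξ 0 0 ^ 2 + ξ 0 1 ^ 2 + ξ 1 0 ^ 2 + ξ 1 1 ^ 2 := by
  have hn : Module.finrank ℝ (EuclideanSpace ℝ (Fin 2)) = 2 := by simp
  have h := (Matrix.toEuclideanLin ξ).isSymmetric_adjoint_comp_self.trace_eq_sum_eigenvalues hn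
  rw [Fin.sum_univ_two, ← LinearMap.sq_singularValues_fin, ← LinearMap.sq_singularValues_fin,
    adjoint_comp_toEuclideanLin, LinearMap.trace_eq_matrix_trace ℝ
      (EuclideanSpace.basisFun (Fin 2) ℝ).toBasis, LinearMap.toMatrix_toLin] at h
  simp [Matrix.trace, Matrix.mul_apply] at h
  simp only [lam1, lam2]
  linarith

lemma lam1_mul_lam2 (ξ : Mat2) : lam1 ξ * lam2 ξ = |ξ.det| := by
  have hn : Module.finrank ℝ (EuclideanSpace ℝ (Fin 2)) = 2 := by simp
  have h := (Matrix.toEuclideanLin ξ).isSymmetric_adjoint_comp_self.det_eq_prod_eigenvalues hn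
  rw [Fin.prod_univ_two, ← LinearMap.sq_singularValues_fin, ← LinearMap.sq_singularValues_fin,
    adjoint_comp_toEuclideanLin, LinearMap.det_toLin] at h
  simp at h
  rw [← abs_of_nonneg (mul_nonneg (lam1_nonneg ξ) ((lam1_nonneg ξ).trans (lam1_le_lam2 ξ))),
    ← sq_eq_sq_iff_abs_eq_abs]
  simp only [lam1, lam2]
  linarith

/-- The conformal part of a `2 × 2` matrix, as a complex number. -/
noncomputable def conf : Mat2 →ₗ[ℝ] ℂ where
  toFun ξ := ⟨(ξ 0 0 + ξ 1 1) / 2, (ξ 1 0 - ξ 0 1) / 2⟩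
  map_add' ξ η := by apply Complex.ext <;> simp <;> ring
  map_smul' c ξ := by apply Complex.ext <;> simp <;> ring

/-- The anticonformal part of a `2 × 2` matrix, as a complex number. -/
noncomputable def anti : Mat2 →ₗ[ℝ] ℂ where
  toFun ξ := ⟨(ξ 0 0 - ξ 1 1) / 2, (ξ 1 0 + ξ 0 1) / 2⟩
  map_add' ξ η := by apply Complex.ext <;> simp <;> ring
  map_smul' c ξ := by apply Complex.ext <;> simp <;> ring

/-- The matrix with given conformal and anticonformal parts. -/
noncomputable def ofParts : ℂ × ℂ →ₗ[ℝ] Mat2 where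
  toFun v := !![v.1.re + v.2.re, v.2.im - v.1.im; v.1.im + v.2.im, v.1.re - v.2.re]
  map_add' v w := by ext i j; fin_cases i <;> fin_cases j <;> simp <;> ring
  map_smul' c v := by ext i j; fin_cases i <;> fin_cases j <;> simp <;> ring

lemma conf_ofParts (v : ℂ × ℂ) : conf (ofParts v) = v.1 := by
  apply Complex.ext <;> simp [conf, ofParts]
  ring

lemma anti_ofParts (v : ℂ × ℂ) : anti (ofParts v) = v.2 := by
  apply Complex.ext <;> simp [anti, ofParts]
  ring

lemma ofParts_conf_anti (ξ : Mat2) : ofParts (conf ξ, anti ξ) = ξ := by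
  ext i j; fin_cases i <;> fin_cases j <;> (simp [conf, anti, ofParts]; ring)

lemma continuous_conf : Continuous conf := conf.continuous_of_finiteDimensional

lemma continuous_anti : Continuous anti := anti.continuous_of_finiteDimensional

lemma normSq_conf_sub_normSq_anti (ξ : Mat2) : ‖conf ξ‖ ^ 2 - ‖anti ξ‖ ^ 2 = ξ.det := by
  rw [← Complex.normSq_eq_norm_sq, ← Complex.normSq_eq_norm_sq, Matrix.det_fin_two]
  simp [conf, anti, Complex.normSq_apply]
  ring

lemma normSq_conf_add_normSq_anti (ξ : Mat2) :
    2 * (‖conf ξ‖ ^ 2 + ‖anti ξ‖ ^ 2) = ξ 0 0 ^ 2 + ξ 0 1 ^ 2 + ξ 1 0 ^ 2 + ξ 1 1 ^ 2 := by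
  rw [← Complex.normSq_eq_norm_sq, ← Complex.normSq_eq_norm_sq]
  simp [conf, anti, Complex.normSq_apply]
  ring

lemma abs_sq_sub_sq {p q : ℝ} (hp : 0 ≤ p) (hq : 0 ≤ q) :
    |p ^ 2 - q ^ 2| = |p - q| * (p + q) := by
  rw [sq_sub_sq, abs_mul, abs_of_nonneg (add_nonneg hp hq), mul_comm]

lemma lam2_eq (ξ : Mat2) : lam2 ξ = ‖conf ξ‖ + ‖anti ξ‖ := by
  have h1 := lam1_nonneg ξ
  have h2 := lam1_le_lam2 ξ
  have h3 := lam_sq_add_lam_sq ξ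
  have h4 := lam1_mul_lam2 ξ
  rw [← normSq_conf_add_normSq_anti] at h3
  have hp := norm_nonneg (conf ξ)
  have hq := norm_nonneg (anti ξ)
  rw [← normSq_conf_sub_normSq_anti, abs_sq_sub_sq hp hq] at h4
  set p := ‖conf ξ‖
  set q := ‖anti ξ‖
  have ha := abs_nonneg (p - q)
  have hb : |p - q| ≤ p + q := abs_le.2 ⟨by linarith, by linarith⟩
  have hsq := sq_abs (p - q)
  have e1 : lam1 ξ + lam2 ξ = |p - q| + (p + q) := by
    rw [← sq_eq_sq₀ (by linarith) (by linarith)]; nlinarith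
  have e2 : lam2 ξ - lam1 ξ = (p + q) - |p - q| := by
    rw [← sq_eq_sq₀ (by linarith) (by linarith)]; nlinarith
  linarith

lemma lam1_eq (ξ : Mat2) : lam1 ξ = |‖conf ξ‖ - ‖anti ξ‖| := by
  have h3 := lam_sq_add_lam_sq ξ
  rw [← normSq_conf_add_normSq_anti, lam2_eq] at h3
  rw [← sq_eq_sq₀ (lam1_nonneg ξ) (abs_nonneg _), sq_abs]
  linarith

lemma continuous_lam1 : Continuous lam1 := by
  rw [show lam1 = fun ξ => |‖conf ξ‖ - ‖anti ξ‖| from funext lam1_eq]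
  exact (continuous_conf.norm.sub continuous_anti.norm).abs

lemma continuous_lam2 : Continuous lam2 := by
  rw [show lam2 = fun ξ => ‖conf ξ‖ + ‖anti ξ‖ from funext lam2_eq]
  exact continuous_conf.norm.add continuous_anti.norm

lemma lam1_smul {c : ℝ} (hc : 0 ≤ c) (ξ : Mat2) : lam1 (c • ξ) = c * lam1 ξ := by
  rw [lam1_eq, lam1_eq, map_smul, map_smul, norm_smul, norm_smul, Real.norm_of_nonneg hc,
    ← mul_sub, abs_mul, abs_of_nonneg hc]

lemma lam2_smul {c : ℝ} (hc : 0 ≤ c) (ξ : Mat2) : lam2 (c • ξ) = c * lam2 ξ := by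
  rw [lam2_eq, lam2_eq, map_smul, map_smul, norm_smul, norm_smul, Real.norm_of_nonneg hc, mul_add]

/-! ### Planar separation by hyperbolas -/

/-- The level curve `(a + θ)(b - θ) = const` through `(x, y)` is convex with slope `-r` there, so it
stays above its tangent line. -/
lemma tangent_hyperbola_lt {a b x y r θ : ℝ} (ha : 0 < a) (hr : 0 ≤ r) (hθ : 0 ≤ θ)
    (htan : y - θ = r * (x + θ)) (h : r * (a - x) + (b - y) < 0) :
    a * b + θ * (b - a) < x * y + θ * (y - x) := by
  have h1 : (a + θ) * (b - θ) < (a + θ) * (r * (x + θ) - r * (a - x)) :=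
    mul_lt_mul_of_pos_left (by linarith) (by linarith)
  have h2 : (x + θ) * (y - θ) = r * (x + θ) ^ 2 := by rw [htan]; ring
  nlinarith [mul_nonneg hr (sq_nonneg (a - x))]

/-- A point satisfying the inequalities `|x| y + θ (y - |x|) ≤ a b + θ (b - a)` on `[0, B]`, each
for some point of `K`, cannot be strictly separated from the points `(±a, b)` by a function
`x y + c y - d x` with `|d| ≤ c`. -/
lemma exists_mem_le_of_forall_theta {K : Set (ℝ × ℝ)} {B : ℝ}
    (hKT : ∀ p ∈ K, p.1 ≤ p.2) (hKpos : ∀ p ∈ K, 0 < p.1)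
    (hB : ∃ p ∈ K, p.2 = B) (hle : ∀ p ∈ K, p.2 ≤ B) {c d x y : ℝ} (hdc : |d| ≤ c)
    (hxy : |x| ≤ y)
    (hθ : ∀ θ ∈ Set.Icc 0 B, ∃ p ∈ K, |x| * y + θ * (y - |x|) ≤ p.1 * p.2 + θ * (p.2 - p.1)) :
    ∃ p ∈ K, x * y + c * y - d * x ≤ p.1 * p.2 + c * p.2 - d * p.1 ∨
      x * y + c * y - d * x ≤ -(p.1 * p.2) + c * p.2 + d * p.1 := by
  by_contra! hcon
  obtain ⟨⟨A, B'⟩, hAB, rfl⟩ := hB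
  dsimp only at *
  have hA := hKpos _ hAB
  have hA' := hKT _ hAB
  dsimp only at hA hA'
  obtain ⟨hd1, hd2⟩ := abs_le.1 hdc
  have hc : 0 ≤ c := (abs_nonneg d).trans hdc
  have hx0 := abs_nonneg x
  obtain ⟨hx1, hx2⟩ := abs_le.1 (le_refl |x|)
  -- At `θ = B'` the hypothesis reads `(|x| + B')(y - B') ≤ (p.1 + B')(p.2 - B') ≤ 0`.
  have hyB : y ≤ B' := by
    obtain ⟨p, hp, h⟩ := hθ B' ⟨by linarith, le_rfl⟩
    have h1 := hle p hp
    have h2 := hKpos p hp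
    have h3 := hKT p hp
    by_contra! hlt
    nlinarith [mul_pos (by linarith : 0 < |x| + B') (sub_pos.2 hlt),
      mul_nonneg (by linarith : 0 ≤ p.1 + B') (sub_nonneg.2 h1)]
  -- It suffices to find a tangent hyperbola above `K`.
  suffices H : ∃ θ r, 0 ≤ r ∧ 0 ≤ θ ∧ θ ≤ B' ∧ y - θ = r * (|x| + θ) ∧
      ∀ p ∈ K, r * (p.1 - |x|) + (p.2 - y) < 0 ∨
        p.1 * p.2 + θ * (p.2 - p.1) < |x| * y + θ * (y - |x|) by
    obtain ⟨θ, r, hr, hθ0, hθB, htan, hK⟩ := H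
    obtain ⟨p, hp, h⟩ := hθ θ ⟨hθ0, hθB⟩
    refine absurd h (not_le.2 ?_)
    rcases hK p hp with h' | h'
    · exact tangent_hyperbola_lt (hKpos p hp) hr hθ0 htan h'
    · exact h'
  rcases lt_or_ge d y with hdy | hdy
  · have hcon' : ∀ p ∈ K, p.1 * p.2 + c * p.2 - d * p.1 < |x| * y + c * y - d * |x| := by
      intro p hp
      have := (hcon p hp).1
      nlinarith [mul_nonneg (sub_nonneg.2 hx2) (sub_pos.2 hdy).le]
    have hX : 0 < |x| + c := by
      by_contra! h
      have h1 : |x| = 0 := by linarith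
      have h2 : c = 0 := by linarith
      have h3 : d = 0 := by linarith
      have := hcon' _ hAB
      simp only [h1, h2, h3] at this
      nlinarith
    -- `-r` is the slope at `(|x|, y)` of the level curve of `ab + cb - da`, a hyperbola centred at
    -- `(-c, d)`. The choice of `θ` gives the hyperbola centred at `(-θ, θ)` the same tangent.
    obtain ⟨r, hr⟩ : ∃ r, r * (|x| + c) = y - d := ⟨(y - d) / (|x| + c), by field_simp⟩
    have hr0 : 0 < r := by
      by_contra! h
      nlinarith
    obtain ⟨θ, hθ'⟩ : ∃ θ, θ * (1 + r) = y - r * |x| :=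
      ⟨(y - r * |x|) / (1 + r), by field_simp⟩
    have hrx : r * |x| ≤ y := by
      by_contra! h
      nlinarith
    have hθ0 : 0 ≤ θ := by
      by_contra! h
      nlinarith
    have hθy : θ ≤ y := by nlinarith [mul_nonneg hr0.le hx0, mul_nonneg hθ0 hr0.le]
    have hθc : θ ≤ c := by
      by_contra! h
      nlinarith
    refine ⟨θ, r, hr0.le, hθ0, hθy.trans hyB, by linarith, fun p hp => ?_⟩
    -- With `u = p.1 - |x|` and `v = p.2 - y`, the two functions grow from `(|x|, y)` by `uv + (|x|
    -- + c)(ru + v)` and `uv + (|x| + θ)(ru + v)`. Above the tangent, `θ ≤ c` makes the second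
    -- increment the smaller.
    rw [or_iff_not_imp_left, not_lt]
    intro hw
    have := hcon' p hp
    have h1 : (p.1 - |x|) * (p.2 - y) + (|x| + c) * (r * (p.1 - |x|) + (p.2 - y)) < 0 := by
      linear_combination this + hr * (p.1 - |x|)
    have h2 : (|x| + θ) * (r * (p.1 - |x|) + (p.2 - y)) ≤
        (|x| + c) * (r * (p.1 - |x|) + (p.2 - y)) :=
      mul_le_mul_of_nonneg_right (by linarith) hw
    have htan : y - θ = r * (|x| + θ) := by linarith
    linear_combination h1 + h2 + (p.1 - |x|) * htan
  · rcases le_or_gt d B' with hdB | hdB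
    -- The highest point of `K` is not separated: `(x + c)(y - d) ≤ 0 ≤ (A + c)(B' - d)`.
    · have h1 := (hcon _ hAB).1
      dsimp only at h1
      nlinarith [mul_nonneg (by linarith : 0 ≤ x + c) (sub_nonneg.2 hdy),
        mul_nonneg (by linarith : 0 ≤ A + c) (sub_nonneg.2 hdB)]
    -- Now `d` exceeds every `b`, and the reflected points `(-a, b)` are used. The level curve is
    -- centred at `(c, d)` and bends the other way, so all of `K` lies strictly below its tangent.
    · have hcon' : ∀ p ∈ K, -(p.1 * p.2) + c * p.2 + d * p.1 < -(|x| * y) + c * y + d * |x| := by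
        intro p hp
        have := (hcon p hp).2
        nlinarith [mul_nonneg (by linarith : 0 ≤ |x| + x) (sub_nonneg.2 hdy)]
      have hX : 0 < c - |x| := by linarith
      obtain ⟨r, hr⟩ : ∃ r, r * (c - |x|) = d - y := ⟨(d - y) / (c - |x|), by field_simp⟩
      have hr0 : 0 < r := by
        by_contra! h
        nlinarith
      obtain ⟨θ, hθ'⟩ : ∃ θ, θ * (1 + r) = y - r * |x| :=
        ⟨(y - r * |x|) / (1 + r), by field_simp⟩
      have hrx : r * |x| ≤ y := by
        by_contra! h
        nlinarith
      have hθ0 : 0 ≤ θ := by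
        by_contra! h
        nlinarith
      have hθy : θ ≤ y := by nlinarith [mul_nonneg hr0.le hx0, mul_nonneg hθ0 hr0.le]
      refine ⟨θ, r, hr0.le, hθ0, hθy.trans hyB, by linarith, fun p hp => ?_⟩
      left
      by_contra! hw
      have h0 := hcon' p hp
      have h1 : (c - |x|) * (r * (p.1 - |x|) + (p.2 - y)) < (p.1 - |x|) * (p.2 - y) := by
        linear_combination h0 + hr * (p.1 - |x|)
      have huv : 0 < (p.1 - |x|) * (p.2 - y) := (mul_nonneg hX.le hw).trans_lt h1
      have hb := hle p hp
      rcases pos_and_pos_or_neg_and_neg_of_mul_pos huv with ⟨hu, hv⟩ | ⟨hu, hv⟩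
      · nlinarith [mul_pos hX hv]
      · nlinarith

/-! ### Attainment and continuity of `σ` -/

lemma exists_eq_maxB_and_le {K : Set (ℝ × ℝ)} (hK : IsCompact K) (hne : K.Nonempty) :
    (∃ p ∈ K, p.2 = maxB K) ∧ ∀ p ∈ K, p.2 ≤ maxB K := by
  have hc : IsCompact (Prod.snd '' K) := hK.image continuous_snd
  exact ⟨(hc.sSup_mem (hne.image _)), fun p hp => le_csSup hc.bddAbove ⟨p, hp, rfl⟩⟩

lemma continuous_m {K : Set (ℝ × ℝ)} (hK : IsCompact K) : Continuous (m K) := by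
  refine hK.continuous_sSup (f := fun θ (p : ℝ × ℝ) => p.1 * p.2 + θ * (p.2 - p.1)) ?_
  fun_prop

lemma le_m {K : Set (ℝ × ℝ)} (hK : IsCompact K) (θ : ℝ) {p : ℝ × ℝ} (hp : p ∈ K) :
    p.1 * p.2 + θ * (p.2 - p.1) ≤ m K θ := by
  have hc : IsCompact ((fun p : ℝ × ℝ => p.1 * p.2 + θ * (p.2 - p.1)) '' K) :=
    hK.image (by fun_prop)
  exact le_csSup hc.bddAbove ⟨p, hp, rfl⟩

lemma exists_eq_m {K : Set (ℝ × ℝ)} (hK : IsCompact K) (hne : K.Nonempty) (θ : ℝ) :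
    ∃ p ∈ K, p.1 * p.2 + θ * (p.2 - p.1) = m K θ := by
  have hc : IsCompact ((fun p : ℝ × ℝ => p.1 * p.2 + θ * (p.2 - p.1)) '' K) :=
    hK.image (by fun_prop)
  exact hc.sSup_mem (hne.image _)

lemma maxB_pos {K : Set (ℝ × ℝ)} (hK : IsCompact K) (hne : K.Nonempty)
    (hKT : ∀ p ∈ K, p.1 ≤ p.2) (hKpos : ∀ p ∈ K, 0 < p.1) : 0 < maxB K := by
  obtain ⟨p, hp⟩ := hne
  exact (hKpos p hp).trans_le ((hKT p hp).trans ((exists_eq_maxB_and_le hK ⟨p, hp⟩).2 p hp))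

lemma m_pos {K : Set (ℝ × ℝ)} (hK : IsCompact K) (hne : K.Nonempty)
    (hKT : ∀ p ∈ K, p.1 ≤ p.2) (hKpos : ∀ p ∈ K, 0 < p.1) {θ : ℝ} (hθ : 0 ≤ θ) : 0 < m K θ := by
  obtain ⟨p, hp⟩ := hne
  have h1 := hKpos p hp
  have h2 := hKT p hp
  exact (add_pos_of_pos_of_nonneg (mul_pos h1 (h1.trans_le h2))
    (mul_nonneg hθ (sub_nonneg.2 h2))).trans_le (le_m hK θ hp)

/-- The pairs `(x, y)` for which `x y + θ (y - x) < m(θ)` for all `θ ∈ [0, max b]`. -/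
def belowSigma (K : Set (ℝ × ℝ)) : Set (ℝ × ℝ) :=
  {q | ∀ θ ∈ Set.Icc 0 (maxB K), q.1 * q.2 + θ * (q.2 - q.1) < m K θ}

/-- Tube lemma: `θ` ranges over a compact interval. -/
lemma isOpen_belowSigma {K : Set (ℝ × ℝ)} (hK : IsCompact K) : IsOpen (belowSigma K) := by
  rw [isOpen_iff_mem_nhds]
  intro q hq
  refine isCompact_Icc.eventually_forall_of_forall_eventually
    (P := fun (q : ℝ × ℝ) θ => q.1 * q.2 + θ * (q.2 - q.1) < m K θ) fun θ hθ => ?_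
  refine ContinuousAt.eventually_lt (f := fun z : (ℝ × ℝ) × ℝ =>
    z.1.1 * z.1.2 + z.2 * (z.1.2 - z.1.1)) (g := fun z => m K z.2) ?_ ?_ (hq θ hθ)
  · fun_prop
  · exact ((continuous_m hK).comp continuous_snd).continuousAt

lemma sigmaValues_nonneg {K : Set (ℝ × ℝ)} (hK : IsCompact K) (hne : K.Nonempty)
    (hKT : ∀ p ∈ K, p.1 ≤ p.2) (hKpos : ∀ p ∈ K, 0 < p.1) {x : ℝ} (hx : 0 ≤ x) :
    0 ∈ lowerBounds (sigmaValues K x) := by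
  rintro _ ⟨θ, hθ, h, rfl⟩
  exact div_nonneg (add_nonneg (mul_nonneg hθ.1 hx) (m_pos hK hne hKT hKpos hθ.1).le) h.le

lemma mem_belowSigma_iff {K : Set (ℝ × ℝ)} (hK : IsCompact K) (hne : K.Nonempty)
    (hKT : ∀ p ∈ K, p.1 ≤ p.2) (hKpos : ∀ p ∈ K, 0 < p.1) {x y : ℝ} (hx : 0 ≤ x) :
    (x, y) ∈ belowSigma K ↔ ∀ v ∈ sigmaValues K x, y < v := by
  constructor
  · rintro h _ ⟨θ, hθ, hpos, rfl⟩
    have := h θ hθ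
    rw [lt_div_iff₀ hpos]
    dsimp only at this
    linarith
  · intro h θ hθ
    dsimp only
    -- The omitted parameter `x = θ = 0` costs nothing: its condition is `0 < m(0)`.
    rcases (add_nonneg hx hθ.1).eq_or_lt with h0 | h0
    · have hx0 : x = 0 := by linarith [hθ.1]
      have hθ0 : θ = 0 := by linarith
      simpa [hx0, hθ0] using m_pos hK hne hKT hKpos le_rfl
    · have := h _ ⟨θ, hθ, h0, rfl⟩
      rw [lt_div_iff₀ h0] at this
      linarith

/-- An infimum that is not attained would put `(x, σ(x))` in the open set `belowSigma`, hence also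
some `(x, y)` with `y > σ(x)`. -/
lemma isLeast_sigma {K : Set (ℝ × ℝ)} (hK : IsCompact K) (hne : K.Nonempty)
    (hKT : ∀ p ∈ K, p.1 ≤ p.2) (hKpos : ∀ p ∈ K, 0 < p.1) {x : ℝ} (hx : 0 ≤ x) :
    IsLeast (sigmaValues K x) (sigma K x) := by
  have hbdd : BddBelow (sigmaValues K x) := ⟨0, sigmaValues_nonneg hK hne hKT hKpos hx⟩
  have hB := maxB_pos hK hne hKT hKpos
  refine ⟨?_, fun v hv => csInf_le hbdd hv⟩
  by_contra hnot
  have hmem : (x, sigma K x) ∈ belowSigma K := by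
    rw [mem_belowSigma_iff hK hne hKT hKpos hx]
    intro v hv
    refine (csInf_le hbdd hv).lt_of_ne ?_
    rintro rfl
    exact hnot hv
  have hev : ∀ᶠ y in 𝓝 (sigma K x), (x, y) ∈ belowSigma K :=
    (by fun_prop : Continuous fun y : ℝ => (x, y)).continuousAt.eventually_mem
      ((isOpen_belowSigma hK).mem_nhds hmem)
  obtain ⟨y, hy, hlt⟩ := (hev.filter_mono nhdsWithin_le_nhds).and
    (self_mem_nhdsWithin : Set.Ioi (sigma K x) ∈ 𝓝[>] (sigma K x)) |>.exists
  refine absurd (le_csInf ?_ fun v hv =>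
    ((mem_belowSigma_iff hK hne hKT hKpos hx).1 hy v hv).le) (not_le.2 hlt)
  exact ⟨_, maxB K, ⟨hB.le, le_rfl⟩, by linarith, rfl⟩

lemma mem_belowSigma_iff_lt_sigma {K : Set (ℝ × ℝ)} (hK : IsCompact K) (hne : K.Nonempty)
    (hKT : ∀ p ∈ K, p.1 ≤ p.2) (hKpos : ∀ p ∈ K, 0 < p.1) {x y : ℝ} (hx : 0 ≤ x) :
    (x, y) ∈ belowSigma K ↔ y < sigma K x := by
  have h := isLeast_sigma hK hne hKT hKpos hx
  rw [mem_belowSigma_iff hK hne hKT hKpos hx]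
  exact ⟨fun H => H _ h.1, fun H v hv => H.trans_le (h.2 hv)⟩

/-- Lower semicontinuity is openness of `belowSigma`; upper semicontinuity holds because a
minimizing `θ` stays admissible nearby. -/
lemma continuousOn_sigma {K : Set (ℝ × ℝ)} (hK : IsCompact K) (hne : K.Nonempty)
    (hKT : ∀ p ∈ K, p.1 ≤ p.2) (hKpos : ∀ p ∈ K, 0 < p.1) :
    ContinuousOn (sigma K) (Set.Ici 0) := by
  intro x hx
  refine tendsto_order.2 ⟨fun y hy => ?_, fun y hy => ?_⟩
  · have hev : ∀ᶠ x' in 𝓝 x, (x', y) ∈ belowSigma K :=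
      (by fun_prop : Continuous fun x' : ℝ => (x', y)).continuousAt.eventually_mem
        ((isOpen_belowSigma hK).mem_nhds
          ((mem_belowSigma_iff_lt_sigma hK hne hKT hKpos hx).2 hy))
    filter_upwards [hev.filter_mono nhdsWithin_le_nhds, self_mem_nhdsWithin] with x' h hx'
    exact (mem_belowSigma_iff_lt_sigma hK hne hKT hKpos hx').1 h
  · obtain ⟨θ, hθ, hpos, heq⟩ := (isLeast_sigma hK hne hKT hKpos hx).1
    rw [heq] at hy
    have h1 : ContinuousAt (fun x : ℝ => (θ * x + m K θ) / (x + θ)) x :=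
      ContinuousAt.div (by fun_prop) (by fun_prop) hpos.ne'
    have h2 : ContinuousAt (fun x : ℝ => x + θ) x := by fun_prop
    filter_upwards [(h1.eventually_lt_const hy).filter_mono nhdsWithin_le_nhds,
      (h2.eventually_const_lt hpos).filter_mono nhdsWithin_le_nhds, self_mem_nhdsWithin]
      with x' h3 h4 hx'
    exact ((isLeast_sigma hK hne hKT hKpos hx').2 ⟨θ, hθ, h4, rfl⟩).trans_lt h3

/-! ### Compactness of convex hulls, by Carathéodory -/

lemma isCompact_convexHull_of_isCompact {E : Type*} [NormedAddCommGroup E] [NormedSpace ℝ E]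
    [FiniteDimensional ℝ E] {s : Set E} (hs : IsCompact s) : IsCompact (convexHull ℝ s) := by
  let Φ : (k : ℕ) → (Fin k → ℝ) × (Fin k → E) → E := fun k v => ∑ i, v.1 i • v.2 i
  have h : convexHull ℝ s = ⋃ k ∈ Finset.range (Module.finrank ℝ E + 2),
      Φ k '' (stdSimplex ℝ (Fin k) ×ˢ Set.univ.pi fun _ => s) := by
    apply Set.Subset.antisymm
    · intro x hx
      obtain ⟨ι, _, z, w, hz, hi, hw, hw1, rfl⟩ := eq_pos_convex_span_of_mem_convexHull hx
      let e := Fintype.equivFin ι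
      have hcard : Fintype.card ι ≤ Module.finrank ℝ E + 1 :=
        hi.card_le_finrank_succ.trans (Nat.succ_le_succ (Submodule.finrank_le _))
      refine Set.mem_iUnion₂.2 ⟨Fintype.card ι, Finset.mem_range.2 (by omega),
        (fun i => w (e.symm i), fun i => z (e.symm i)), ⟨⟨fun i => (hw _).le, ?_⟩, ?_⟩, ?_⟩
      · rw [← hw1]
        exact e.symm.sum_comp w
      · exact fun i _ => hz ⟨_, rfl⟩
      · exact e.symm.sum_comp fun i => w i • z i
    · refine Set.iUnion₂_subset fun k _ => ?_
      rintro _ ⟨⟨w, z⟩, ⟨⟨hw, hw1⟩, hz⟩, rfl⟩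
      exact (convex_convexHull ℝ s).sum_mem (fun i _ => hw i) hw1
        fun i _ => subset_convexHull ℝ s (hz i trivial)
  rw [h]
  refine (Finset.range _).isCompact_biUnion fun k _ => ?_
  refine ((isCompact_stdSimplex ℝ (Fin k)).prod (isCompact_univ_pi fun _ => hs)).image ?_
  fun_prop

/-! ### Necessity: polyconvex test functions -/

/-- The function `max (det + 2 θ |w|, -det + 2 θ |z|) - c` of a matrix and its determinant. -/
noncomputable def gTheta (θ c : ℝ) (v : Mat2 × ℝ) : ℝ :=
  max (v.2 + 2 * θ * ‖anti v.1‖) (-v.2 + 2 * θ * ‖conf v.1‖) - c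

lemma gTheta_convex {θ : ℝ} (hθ : 0 ≤ θ) (c : ℝ) (x y : Mat2 × ℝ) {a b : ℝ} (ha : 0 < a)
    (hb : 0 < b) (hab : a + b = 1) :
    gTheta θ c (a • x + b • y) ≤ a * gTheta θ c x + b * gTheta θ c y := by
  have key (L : Mat2 →ₗ[ℝ] ℂ) :
      2 * θ * ‖L (a • x.1 + b • y.1)‖ ≤ a * (2 * θ * ‖L x.1‖) + b * (2 * θ * ‖L y.1‖) := by
    have h : ‖L (a • x.1 + b • y.1)‖ ≤ a * ‖L x.1‖ + b * ‖L y.1‖ := by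
      rw [map_add, map_smul, map_smul]
      refine (norm_add_le _ _).trans_eq ?_
      rw [norm_smul, norm_smul, Real.norm_of_nonneg ha.le, Real.norm_of_nonneg hb.le]
    have := mul_le_mul_of_nonneg_left h (by linarith : 0 ≤ 2 * θ)
    linarith
  have hc : c = a * c + b * c := by rw [← add_mul, hab, one_mul]
  have e1 := key anti
  have e2 := key conf
  simp only [gTheta, Prod.fst_add, Prod.snd_add, Prod.smul_fst, Prod.smul_snd, smul_eq_mul]
  have m1 := mul_le_mul_of_nonneg_left
    (le_max_left (x.2 + 2 * θ * ‖anti x.1‖) (-x.2 + 2 * θ * ‖conf x.1‖)) ha.le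
  have m2 := mul_le_mul_of_nonneg_left
    (le_max_right (x.2 + 2 * θ * ‖anti x.1‖) (-x.2 + 2 * θ * ‖conf x.1‖)) ha.le
  have m3 := mul_le_mul_of_nonneg_left
    (le_max_left (y.2 + 2 * θ * ‖anti y.1‖) (-y.2 + 2 * θ * ‖conf y.1‖)) hb.le
  have m4 := mul_le_mul_of_nonneg_left
    (le_max_right (y.2 + 2 * θ * ‖anti y.1‖) (-y.2 + 2 * θ * ‖conf y.1‖)) hb.le
  rw [sub_le_iff_le_add]
  refine max_le ?_ ?_ <;> linarith

lemma isPolyconvex_gTheta {θ : ℝ} (hθ : 0 ≤ θ) (c : ℝ) :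
    IsPolyconvex fun ξ => (gTheta θ c (ξ, ξ.det) : EReal) := by
  refine ⟨fun v => (gTheta θ c v : EReal), ⟨fun v => EReal.coe_ne_bot _, ?_⟩, fun ξ => rfl⟩
  intro x y a b ha hb hab
  dsimp only
  exact_mod_cast gTheta_convex hθ c x y ha hb hab

lemma gTheta_eq (θ c : ℝ) (ξ : Mat2) :
    gTheta θ c (ξ, ξ.det) = max (lam1 ξ * lam2 ξ + θ * (lam2 ξ - lam1 ξ))
      (-(lam1 ξ * lam2 ξ) + θ * (lam1 ξ + lam2 ξ)) - c := by
  have hp := norm_nonneg (conf ξ)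
  have hq := norm_nonneg (anti ξ)
  rw [gTheta, lam1_mul_lam2, lam1_eq, lam2_eq, ← normSq_conf_sub_normSq_anti,
    abs_sq_sub_sq hp hq]
  dsimp only
  rcases abs_cases (‖conf ξ‖ - ‖anti ξ‖) with ⟨h, h'⟩ | ⟨h, h'⟩ <;> rw [h]
  · congr 2 <;> ring
  · rw [max_comm]
    congr 2 <;> ring

/-- Points of the polyconvex hull satisfy `λ₁ λ₂ + θ (λ₂ - λ₁) ≤ m(θ)` for `θ ∈ [0, max b]`. -/
lemma le_m_of_mem_Pco {K : Set (ℝ × ℝ)} (hK : IsCompact K) (hne : K.Nonempty)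
    (hKT : ∀ p ∈ K, p.1 ≤ p.2) (hKpos : ∀ p ∈ K, 0 < p.1) {ξ : Mat2}
    (hξ : ξ ∈ Pco (isotropicSet K)) {θ : ℝ} (hθ : θ ∈ Set.Icc 0 (maxB K)) :
    lam1 ξ * lam2 ξ + θ * (lam2 ξ - lam1 ξ) ≤ m K θ := by
  have h := hξ _ (isPolyconvex_gTheta hθ.1 (m K θ)) ?_
  · have h' : gTheta θ (m K θ) (ξ, ξ.det) ≤ 0 := by exact_mod_cast h
    rw [gTheta_eq, sub_nonpos] at h'
    exact (le_max_left _ _).trans h'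
  · intro η hη
    have h' : gTheta θ (m K θ) (η, η.det) ≤ 0 := by
      rw [gTheta_eq, sub_nonpos]
      have h1 := le_m hK θ hη
      refine max_le h1 ?_
      dsimp only at h1
      have ha := hKpos _ hη
      have hab := hKT _ hη
      dsimp only at ha hab
      rcases le_total θ (lam2 η) with hle | hle
      · nlinarith [mul_nonneg ha.le (sub_nonneg.2 hle)]
      -- Here `λ₂ ≤ θ ≤ max b`. A point of `K` with `b = max b` gives `m(θ) ≥ θ²`, and `θ² + λ₁λ₂ -
      -- θ(λ₁ + λ₂) = (θ - λ₁)(θ - λ₂) ≥ 0`.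
      · obtain ⟨⟨p, hp, hpB⟩, -⟩ := exists_eq_maxB_and_le hK hne
        have h2 := le_m hK θ hp
        have h3 := hKpos p hp
        have h4 := hθ.2
        rw [hpB] at h2
        nlinarith [mul_nonneg (sub_nonneg.2 hle) (by linarith : 0 ≤ θ - lam1 η),
          mul_nonneg h3.le (sub_nonneg.2 h4), mul_nonneg hθ.1 (sub_nonneg.2 h4)]
    exact_mod_cast h'

/-- Some `t • ξ` with `t > 1` is still in the hull, and passing from it to `ξ` strictly decreases
the left side unless that side is `0 < m(θ)`. -/
lemma mem_belowSigma_of_mem_interior {K : Set (ℝ × ℝ)} (hK : IsCompact K) (hne : K.Nonempty)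
    (hKT : ∀ p ∈ K, p.1 ≤ p.2) (hKpos : ∀ p ∈ K, 0 < p.1) {ξ : Mat2}
    (hξ : ξ ∈ interior (Pco (isotropicSet K))) : (lam1 ξ, lam2 ξ) ∈ belowSigma K := by
  have hc : ContinuousAt (fun t : ℝ => t • ξ) 1 := by fun_prop
  have hev : ∀ᶠ t in 𝓝 (1 : ℝ), t • ξ ∈ Pco (isotropicSet K) :=
    hc.eventually_mem (by rw [one_smul]; exact mem_interior_iff_mem_nhds.1 hξ)
  obtain ⟨t, ht, ht1⟩ := (hev.filter_mono nhdsWithin_le_nhds).and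
    (self_mem_nhdsWithin : Set.Ioi (1 : ℝ) ∈ 𝓝[>] 1) |>.exists
  have ht1' : 1 < t := ht1
  intro θ hθ
  dsimp only
  have h := le_m_of_mem_Pco hK hne hKT hKpos ht hθ
  rw [lam1_smul (by linarith), lam2_smul (by linarith)] at h
  have h1 := lam1_nonneg ξ
  have h2 := lam1_le_lam2 ξ
  have hP : 0 ≤ lam1 ξ * lam2 ξ := mul_nonneg h1 (h1.trans h2)
  have hQ : 0 ≤ θ * (lam2 ξ - lam1 ξ) := mul_nonneg hθ.1 (sub_nonneg.2 h2)
  rcases (add_nonneg hP hQ).eq_or_lt with h0 | h0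
  · rw [← h0]
    exact m_pos hK hne hKT hKpos hθ.1
  · nlinarith [mul_pos (sub_pos.2 ht1') h0, mul_nonneg (mul_nonneg (sub_pos.2 ht1').le
      (by linarith : 0 ≤ t)) hP]

/-! ### Sufficiency: convex hull of the lifted set -/

/-- Riesz representation: `s` is the norm of the representing vector, and the bound is attained on
every circle. -/
lemma exists_norm_bound (f : ℂ →L[ℝ] ℝ) : ∃ s, 0 ≤ s ∧ (∀ z, f z ≤ s * ‖z‖) ∧
    ∀ r, 0 ≤ r → ∃ z, ‖z‖ = r ∧ f z = s * r := by
  have hf (z : ℂ) : f z = z.re * f 1 + z.im * f Complex.I := by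
    conv_lhs => rw [show z = z.re • (1 : ℂ) + z.im • Complex.I by
      apply Complex.ext <;> simp]
    rw [map_add, map_smul, map_smul, smul_eq_mul, smul_eq_mul]
  set α : ℂ := ⟨f 1, f Complex.I⟩ with hα
  have hsq : ‖α‖ * ‖α‖ = f 1 * f 1 + f Complex.I * f Complex.I := by
    rw [← sq, ← Complex.normSq_eq_norm_sq, Complex.normSq_apply]
  refine ⟨‖α‖, norm_nonneg _, fun z => ?_, fun r hr => ?_⟩
  · have h : f z = ((starRingEnd ℂ) α * z).re := by
      rw [hf, Complex.mul_re]
      simp [hα]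
      ring
    rw [h]
    refine (Complex.re_le_norm _).trans_eq ?_
    rw [norm_mul, RCLike.norm_conj]
  · rcases eq_or_ne α 0 with h0 | h0
    · have h1 : f 1 = 0 := congrArg Complex.re h0
      have h2 : f Complex.I = 0 := congrArg Complex.im h0
      exact ⟨r, by simp [abs_of_nonneg hr], by rw [hf, h1, h2, h0]; simp⟩
    · have hpos := norm_pos_iff.2 h0
      refine ⟨(r / ‖α‖) • α, ?_, ?_⟩
      · rw [norm_smul, Real.norm_of_nonneg (by positivity)]
        field_simp
      · rw [map_smul, hf, smul_eq_mul, show α.re = f 1 from rfl, show α.im = f Complex.I from rfl,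
          ← hsq]
        field_simp

/-- The set of triples (conformal part, anticonformal part, determinant) of the matrices of the
isotropic set. -/
def liftedSet (K : Set (ℝ × ℝ)) : Set (ℂ × ℂ × ℝ) :=
  {v | (|‖v.1‖ - ‖v.2.1‖|, ‖v.1‖ + ‖v.2.1‖) ∈ K ∧ v.2.2 = ‖v.1‖ ^ 2 - ‖v.2.1‖ ^ 2}

lemma isCompact_liftedSet {K : Set (ℝ × ℝ)} (hK : IsCompact K) : IsCompact (liftedSet K) := by
  let S : Set (ℂ × ℂ) := {v | (|‖v.1‖ - ‖v.2‖|, ‖v.1‖ + ‖v.2‖) ∈ K}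
  have hS : IsCompact S := by
    refine Metric.isCompact_of_isClosed_isBounded (hK.isClosed.preimage (by fun_prop)) ?_
    obtain ⟨R, hR⟩ := hK.isBounded.exists_norm_le
    refine isBounded_iff_forall_norm_le.2 ⟨R, fun v hv => ?_⟩
    have h := (norm_snd_le _).trans (hR _ hv)
    dsimp only at h
    rw [Real.norm_of_nonneg (by positivity)] at h
    exact max_le (by linarith [norm_nonneg v.2]) (by linarith [norm_nonneg v.1])
  have h : liftedSet K = (fun v : ℂ × ℂ => (v.1, v.2, ‖v.1‖ ^ 2 - ‖v.2‖ ^ 2)) '' S := by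
    ext ⟨z, w, δ⟩
    constructor
    · rintro ⟨h1, h2⟩
      exact ⟨(z, w), h1, Prod.ext rfl (Prod.ext rfl h2.symm)⟩
    · rintro ⟨⟨z', w'⟩, h1, h2⟩
      simp only [Prod.mk.injEq] at h2
      obtain ⟨rfl, rfl, rfl⟩ := h2
      exact ⟨h1, rfl⟩
  rw [h]
  exact hS.image (by fun_prop)

/-- With `x = p - q` and `y = p + q`, the function is `γ(xy + cy - dx)`. The points `(a, b)` and
`(-a, b)` correspond to the two signs of the determinant. -/
lemma exists_parts_ge_of_pos {K : Set (ℝ × ℝ)} (hK : IsCompact K) (hne : K.Nonempty)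
    (hKT : ∀ p ∈ K, p.1 ≤ p.2) (hKpos : ∀ p ∈ K, 0 < p.1) {p q s t γ : ℝ} (hp : 0 ≤ p)
    (hq : 0 ≤ q) (hs : 0 ≤ s) (ht : 0 ≤ t) (hγ : 0 < γ)
    (hpq : (|p - q|, p + q) ∈ belowSigma K) :
    ∃ p' q' : ℝ, 0 ≤ p' ∧ 0 ≤ q' ∧ (|p' - q'|, p' + q') ∈ K ∧
      s * p + t * q + γ * (p ^ 2 - q ^ 2) ≤ s * p' + t * q' + γ * (p' ^ 2 - q' ^ 2) := by
  obtain ⟨hB, hle⟩ := exists_eq_maxB_and_le hK hne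
  obtain ⟨⟨a, b⟩, hab, h⟩ := exists_mem_le_of_forall_theta hKT hKpos hB hle
    (c := (s + t) / (2 * γ)) (d := (t - s) / (2 * γ)) (x := p - q) (y := p + q)
    (by
      rw [abs_div, abs_of_pos (by linarith : 0 < 2 * γ)]
      exact div_le_div_of_nonneg_right (abs_le.2 ⟨by linarith, by linarith⟩) (by linarith))
    (abs_le.2 ⟨by linarith, by linarith⟩)
    (fun θ hθ => by
      obtain ⟨v, hv, hvm⟩ := exists_eq_m hK hne θ
      exact ⟨v, hv, hvm ▸ (hpq θ hθ).le⟩)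
  have ha := hKpos _ hab
  have hba := hKT _ hab
  dsimp only at h ha hba
  have hγ' : γ ≠ 0 := hγ.ne'
  have e0 : γ * ((p - q) * (p + q) + (s + t) / (2 * γ) * (p + q) - (t - s) / (2 * γ) * (p - q)) =
      s * p + t * q + γ * (p ^ 2 - q ^ 2) := by field_simp; ring
  rcases h with h | h
  · refine ⟨(a + b) / 2, (b - a) / 2, by linarith, by linarith, ?_, ?_⟩
    · rwa [show (a + b) / 2 - (b - a) / 2 = a by ring, abs_of_pos ha,
        show (a + b) / 2 + (b - a) / 2 = b by ring]
    · rw [← e0]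
      refine (mul_le_mul_of_nonneg_left h hγ.le).trans_eq ?_
      field_simp
      ring
  · refine ⟨(b - a) / 2, (a + b) / 2, by linarith, by linarith, ?_, ?_⟩
    · rwa [show (b - a) / 2 - (a + b) / 2 = -a by ring, abs_neg, abs_of_pos ha,
        show (b - a) / 2 + (a + b) / 2 = b by ring]
    · rw [← e0]
      refine (mul_le_mul_of_nonneg_left h hγ.le).trans_eq ?_
      field_simp
      ring

lemma exists_parts_ge_of_ne_zero {K : Set (ℝ × ℝ)} (hK : IsCompact K) (hne : K.Nonempty)
    (hKT : ∀ p ∈ K, p.1 ≤ p.2) (hKpos : ∀ p ∈ K, 0 < p.1) {p q s t γ : ℝ} (hp : 0 ≤ p)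
    (hq : 0 ≤ q) (hs : 0 ≤ s) (ht : 0 ≤ t) (hγ : γ ≠ 0)
    (hpq : (|p - q|, p + q) ∈ belowSigma K) :
    ∃ p' q' : ℝ, 0 ≤ p' ∧ 0 ≤ q' ∧ (|p' - q'|, p' + q') ∈ K ∧
      s * p + t * q + γ * (p ^ 2 - q ^ 2) ≤ s * p' + t * q' + γ * (p' ^ 2 - q' ^ 2) := by
  rcases hγ.lt_or_gt with h | h
  · rw [abs_sub_comm, add_comm] at hpq
    obtain ⟨q', p', hq', hp', hmem, hle⟩ :=
      exists_parts_ge_of_pos hK hne hKT hKpos hq hp ht hs (neg_pos.2 h) hpq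
    rw [abs_sub_comm, add_comm] at hmem
    exact ⟨p', q', hp', hq', hmem, by linarith⟩
  · exact exists_parts_ge_of_pos hK hne hKT hKpos hp hq hs ht h hpq

lemma not_separated {K : Set (ℝ × ℝ)} (hK : IsCompact K) (hne : K.Nonempty)
    (hKT : ∀ p ∈ K, p.1 ≤ p.2) (hKpos : ∀ p ∈ K, 0 < p.1) {p q s t γ u : ℝ} (hp : 0 ≤ p)
    (hq : 0 ≤ q) (hs : 0 ≤ s) (ht : 0 ≤ t) (hpq : (|p - q|, p + q) ∈ belowSigma K)
    (hu : ∀ p' q' : ℝ, 0 ≤ p' → 0 ≤ q' → (|p' - q'|, p' + q') ∈ K →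
      s * p' + t * q' + γ * (p' ^ 2 - q' ^ 2) < u) :
    s * p + t * q + γ * (p ^ 2 - q ^ 2) ≤ u := by
  by_contra! hlt
  rcases ne_or_eq γ 0 with hγ | rfl
  · obtain ⟨p', q', hp', hq', hmem, hle⟩ :=
      exists_parts_ge_of_ne_zero hK hne hKT hKpos hp hq hs ht hγ hpq
    linarith [hu p' q' hp' hq' hmem]
  -- For `γ = 0`, add a multiple `ε` of the determinant so small that its variation, at most `D`,
  -- cannot exceed the separation gap.
  · set D := maxB K ^ 2 + |p ^ 2 - q ^ 2| + 1 with hD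
    have hD0 : 0 < D := by positivity
    obtain ⟨ε, hε⟩ : ∃ ε, ε * D = s * p + t * q - u := ⟨(s * p + t * q - u) / D, by field_simp⟩
    have hε0 : 0 < ε := by
      by_contra! h
      nlinarith
    obtain ⟨p', q', hp', hq', hmem, hle⟩ :=
      exists_parts_ge_of_ne_zero hK hne hKT hKpos hp hq hs ht hε0.ne' hpq
    have h1 := hu p' q' hp' hq' hmem
    have h2 : p' + q' ≤ maxB K := (exists_eq_maxB_and_le hK hne).2 _ hmem
    have h3 : p' ^ 2 - q' ^ 2 ≤ maxB K ^ 2 := by nlinarith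
    have h4 : p' ^ 2 - q' ^ 2 - (p ^ 2 - q ^ 2) ≤ D := by linarith [neg_abs_le (p ^ 2 - q ^ 2)]
    have h5 := mul_le_mul_of_nonneg_left h4 hε0.le
    linarith

lemma mem_convexHull_liftedSet {K : Set (ℝ × ℝ)} (hK : IsCompact K) (hne : K.Nonempty)
    (hKT : ∀ p ∈ K, p.1 ≤ p.2) (hKpos : ∀ p ∈ K, 0 < p.1) {z w : ℂ}
    (h : (|‖z‖ - ‖w‖|, ‖z‖ + ‖w‖) ∈ belowSigma K) :
    (z, w, ‖z‖ ^ 2 - ‖w‖ ^ 2) ∈ convexHull ℝ (liftedSet K) := by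
  by_contra hnot
  obtain ⟨f, u, hfu, huf⟩ := geometric_hahn_banach_closed_point (convex_convexHull ℝ _)
    (isCompact_convexHull_of_isCompact (isCompact_liftedSet hK)).isClosed hnot
  have hf (z w : ℂ) (δ : ℝ) : f (z, w, δ) =
      f.comp (.inl ℝ ℂ (ℂ × ℝ)) z + f.comp ((ContinuousLinearMap.inr ℝ ℂ (ℂ × ℝ)).comp
        (.inl ℝ ℂ ℝ)) w + f (0, 0, 1) * δ := by
    have : ((z, w, δ) : ℂ × ℂ × ℝ) = (z, 0, 0) + (0, w, 0) + δ • (0, 0, 1) := by simp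
    rw [this, map_add, map_add, map_smul, smul_eq_mul, mul_comm]
    rfl
  obtain ⟨s, hs, hsle, hsex⟩ := exists_norm_bound (f.comp (.inl ℝ ℂ (ℂ × ℝ)))
  obtain ⟨t, ht, htle, htex⟩ := exists_norm_bound
    (f.comp ((ContinuousLinearMap.inr ℝ ℂ (ℂ × ℝ)).comp (.inl ℝ ℂ ℝ)))
  have hle := not_separated hK hne hKT hKpos (γ := f (0, 0, 1)) (u := u) (norm_nonneg z)
    (norm_nonneg w) hs ht h fun p' q' hp' hq' hmem => by
      obtain ⟨z', rfl, hz'⟩ := hsex p' hp'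
      obtain ⟨w', rfl, hw'⟩ := htex q' hq'
      have := hfu (z', w', ‖z'‖ ^ 2 - ‖w'‖ ^ 2) (subset_convexHull ℝ _ ⟨hmem, rfl⟩)
      rwa [hf, hz', hw'] at this
  rw [hf] at huf
  linarith [hsle z, htle w]

lemma convex_setOf_le_zero {V : Type*} [AddCommGroup V] [Module ℝ V] {g : V → EReal}
    (hg : IsConvexExt g) : Convex ℝ {v | g v ≤ 0} := by
  rw [convex_iff_forall_pos]
  intro x hx y hy a b ha hb hab
  refine (hg.2 x y a b ha hb hab).trans (add_nonpos ?_ ?_)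
  · exact mul_nonpos_of_nonneg_of_nonpos (EReal.coe_nonneg.2 ha.le) hx
  · exact mul_nonpos_of_nonneg_of_nonpos (EReal.coe_nonneg.2 hb.le) hy

lemma mem_Pco_of_mem_belowSigma {K : Set (ℝ × ℝ)} (hK : IsCompact K) (hne : K.Nonempty)
    (hKT : ∀ p ∈ K, p.1 ≤ p.2) (hKpos : ∀ p ∈ K, 0 < p.1) {ξ : Mat2}
    (hξ : (lam1 ξ, lam2 ξ) ∈ belowSigma K) : ξ ∈ Pco (isotropicSet K) := by
  rintro f ⟨g, hg, hfg⟩ hfE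
  rw [lam1_eq, lam2_eq] at hξ
  let Ψ : ℂ × ℂ × ℝ →ₗ[ℝ] Mat2 × ℝ :=
    (ofParts.comp (.prodMap .id (.fst ℝ ℂ ℝ))).prod (.comp (.snd ℝ ℂ ℝ) (.snd ℝ ℂ (ℂ × ℝ)))
  -- The sublevel set of `g` is convex, so containing the lift of `E` it contains the hull of the
  -- lift.
  have hsub : liftedSet K ⊆ Ψ ⁻¹' {v | g v ≤ 0} := by
    rintro ⟨z, w, δ⟩ ⟨h1, h2⟩
    dsimp only at h1 h2
    have hmem : ofParts (z, w) ∈ isotropicSet K := by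
      change (lam1 _, lam2 _) ∈ K
      rwa [lam1_eq, lam2_eq, conf_ofParts, anti_ofParts]
    have h := hfE _ hmem
    rw [hfg, ← normSq_conf_sub_normSq_anti, conf_ofParts, anti_ofParts, ← h2] at h
    exact h
  have h : g (ofParts (conf ξ, anti ξ), ‖conf ξ‖ ^ 2 - ‖anti ξ‖ ^ 2) ≤ 0 :=
    convexHull_min hsub ((convex_setOf_le_zero hg).linear_preimage Ψ)
      (mem_convexHull_liftedSet hK hne hKT hKpos hξ)
  rwa [ofParts_conf_anti, normSq_conf_sub_normSq_anti, ← hfg] at h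

end IsotropicHull

theorem mainTheorem4 (K : Set (ℝ × ℝ)) (hKcompact : IsCompact K) (hKne : K.Nonempty)
    (hKT : ∀ p ∈ K, 0 ≤ p.1 ∧ p.1 ≤ p.2) (hKpos : ∀ p ∈ K, 0 < p.1) :
    (∀ x : ℝ, 0 ≤ x →
      IsLeast (IsotropicHull.sigmaValues K x) (IsotropicHull.sigma K x)) ∧
    ContinuousOn (IsotropicHull.sigma K) (Set.Ici 0) ∧
    interior (IsotropicHull.Pco (IsotropicHull.isotropicSet K)) =
      {ξ : IsotropicHull.Mat2 |
        IsotropicHull.lam2 ξ < IsotropicHull.sigma K (IsotropicHull.lam1 ξ)} := by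
  have hT : ∀ p ∈ K, p.1 ≤ p.2 := fun p hp => (hKT p hp).2
  refine ⟨fun x hx => IsotropicHull.isLeast_sigma hKcompact hKne hT hKpos hx,
    IsotropicHull.continuousOn_sigma hKcompact hKne hT hKpos, ?_⟩
  have hset : {ξ : IsotropicHull.Mat2 |
      IsotropicHull.lam2 ξ < IsotropicHull.sigma K (IsotropicHull.lam1 ξ)} =
      {ξ | (IsotropicHull.lam1 ξ, IsotropicHull.lam2 ξ) ∈ IsotropicHull.belowSigma K} := by
    ext ξ
    exact (IsotropicHull.mem_belowSigma_iff_lt_sigma hKcompact hKne hT hKpos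
      (IsotropicHull.lam1_nonneg ξ)).symm
  rw [hset]
  apply Set.Subset.antisymm
  · exact fun ξ hξ =>
      IsotropicHull.mem_belowSigma_of_mem_interior hKcompact hKne hT hKpos hξ
  · exact interior_maximal
      (fun ξ hξ => IsotropicHull.mem_Pco_of_mem_belowSigma hKcompact hKne hT hKpos hξ)
      ((IsotropicHull.isOpen_belowSigma hKcompact).preimage
        (IsotropicHull.continuous_lam1.prodMk IsotropicHull.continuous_lam2))
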